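/- Let $0<\theta<1$. Let $C=\overline{\mathrm{span}}\{e_{i1}\mid i\ge 1\}$ and $R=\overline{\mathrm{span}}\{e_{1j}\mid j\ge 1\}$ in $B(\ell_2)$ be the column and row operator spaces, both identified with $\ell_2$ (hence with each other by transposition), and let $(C,R)_\theta$ be $\ell_2$ equipped with the operator space structure obtained by complex interpolation, i.e. $M_n((C,R)_\theta)=(M_n(C),M_n(R))_\theta$ for every $n\ge 1$. Let $E\subset A$ be an operator space embedded in a (not necessarily unital) $C^*$-algebra $A$, with the norms on $M_n(E)$ induced by $M_n(A)$. Then any linear map $u\colon E\to \ell_2$ for which there are states $f,g$ on $A$ and a constant $C_0\ge 0$ such that $$\forall\, a\in E\qquad \|ua\| \le C_0\, f(a^*a)^{(1-\theta)/2}\, g(aa^*)^{\theta/2}$$ is completely bounded as a mapping from $E$ into $(C,R)_\theta$, with $\|u\|_{cb}\le C_0$. -/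

import Mathlib

open scoped ENNReal NNReal ComplexOrder InnerProductSpace

/-- A state on a (not necessarily unital) C*-algebra: a positive functional of norm one. -/
structure IsState {A : Type*} [NonUnitalCStarAlgebra A] (f : A →L[ℂ] ℂ) : Prop where
  nonneg : ∀ a : A, 0 ≤ f (star a * a)
  norm_eq_one : ‖f‖ = 1

/-- The matrix norms of the operator space obtained from a linear embedding `ι` of `V` into a
C*-algebra `B`: the norm of `x ∈ M_n(V)` is the C*-norm of `(ι (x i j))` in `M_n(B)`. -/
noncomputable def concreteMatrixNorm {V B : Type*} [AddCommGroup V] [Module ℂ V]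
    [NonUnitalCStarAlgebra B] [PartialOrder B] [StarOrderedRing B] (ι : V →ₗ[ℂ] B)
    (n : ℕ) (x : Matrix (Fin n) (Fin n) V) : ℝ≥0∞ :=
  ‖CStarMatrix.ofMatrix (x.map ι)‖ₑ

/-- The cb-norm of `u : V → W` for given families of matrix norms on `V` and on `W`: the supremum
over `n` of the norms of `M_n(V) → M_n(W), (x i j) ↦ (u (x i j))`. -/
noncomputable def cbNorm {V W : Type*} [AddCommGroup V] [Module ℂ V] [AddCommGroup W] [Module ℂ W]
    (NV : ∀ n : ℕ, Matrix (Fin n) (Fin n) V → ℝ≥0∞) (NW : ∀ n : ℕ, Matrix (Fin n) (Fin n) W → ℝ≥0∞)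
    (u : V →ₗ[ℂ] W) : ℝ≥0∞ :=
  ⨆ (n : ℕ) (x : Matrix (Fin n) (Fin n) V) (_ : NV n x ≤ 1), NW n (x.map u)

/-- `u` is completely bounded: its cb-norm is finite. -/
def IsCompletelyBounded {V W : Type*} [AddCommGroup V] [Module ℂ V] [AddCommGroup W] [Module ℂ W]
    (NV : ∀ n : ℕ, Matrix (Fin n) (Fin n) V → ℝ≥0∞) (NW : ∀ n : ℕ, Matrix (Fin n) (Fin n) W → ℝ≥0∞)
    (u : V →ₗ[ℂ] W) : Prop :=
  cbNorm NV NW u < ⊤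

/-- Calderón's space of functions on the closed strip `0 ≤ Re z ≤ 1` for an interpolation couple
`(X₀, X₁)` that consists of one and the same vector space `X` with two norms `N₀`, `N₁`, both
equivalent to the given norm of `X` (so `X₀ = X₁ = X₀ + X₁ = X` up to equivalence of norms). -/
structure IsCalderonFunction {X : Type*} [NormedAddCommGroup X] [NormedSpace ℂ X]
    (N₀ N₁ : X → ℝ≥0∞) (F : ℂ → X) : Prop where
  continuousOn : ContinuousOn F {z : ℂ | 0 ≤ z.re ∧ z.re ≤ 1}
  bounded : ∃ M : ℝ, ∀ z : ℂ, 0 ≤ z.re → z.re ≤ 1 → ‖F z‖ ≤ M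
  holomorphicOn : DifferentiableOn ℂ F {z : ℂ | 0 < z.re ∧ z.re < 1}
  tendsto_zero_left : Filter.Tendsto (fun t : ℝ => N₀ (F (Complex.I * (t : ℂ))))
    (Filter.cocompact ℝ) (nhds 0)
  tendsto_zero_right : Filter.Tendsto (fun t : ℝ => N₁ (F (1 + Complex.I * (t : ℂ))))
    (Filter.cocompact ℝ) (nhds 0)

/-- The norm of the complex interpolation space `(X₀, X₁)_θ`: the infimum, over all functions `F` of
Calderón's space with `F θ = x`, of `max (sup_t N₀ (F (it))) (sup_t N₁ (F (1 + it)))`. -/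
noncomputable def complexInterpolationNorm {X : Type*} [NormedAddCommGroup X] [NormedSpace ℂ X]
    (N₀ N₁ : X → ℝ≥0∞) (θ : ℝ) (x : X) : ℝ≥0∞ :=
  ⨅ (F : ℂ → X) (_ : IsCalderonFunction N₀ N₁ F) (_ : F (θ : ℂ) = x),
    max (⨆ t : ℝ, N₀ (F (Complex.I * (t : ℂ)))) (⨆ t : ℝ, N₁ (F (1 + Complex.I * (t : ℂ))))

/-- The Hilbert space `ℓ₂` of square summable complex sequences. -/
abbrev EllTwo : Type := lp (fun _ : ℕ => ℂ) 2

/-- The first vector of the canonical basis of `ℓ₂`. -/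
noncomputable def EllTwo.e₀ : EllTwo := lp.single 2 0 (1 : ℂ)

/-- The column embedding `ℓ₂ → B(ℓ₂)`: `x` goes to the operator whose matrix has `x` as its first
column and zeros elsewhere, `z ↦ z₀ x`. Its range is `C`. -/
noncomputable def columnEmbedding : EllTwo →ₗ[ℂ] (EllTwo →L[ℂ] EllTwo) where
  toFun x := InnerProductSpace.rankOne ℂ x EllTwo.e₀
  map_add' x y := by simp
  map_smul' c x := by simp

/-- The row embedding `ℓ₂ → B(ℓ₂)`: `x` goes to the operator whose matrix has `x` as its first
row and zeros elsewhere, `z ↦ (∑ j, x j * z j) e₀`. Its range is `R`. -/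
noncomputable def rowEmbedding : EllTwo →ₗ[ℂ] (EllTwo →L[ℂ] EllTwo) where
  toFun x := InnerProductSpace.rankOne ℂ EllTwo.e₀ (star x)
  map_add' x y := by simp
  map_smul' c x := by simp

/-- The matrix norms of the operator space `R[θ] = (C, R)_θ` on `ℓ₂`, where
`M_n((C, R)_θ) = (M_n(C), M_n(R))_θ` and where `C` and `R` are both identified with `ℓ₂`
(that is, with each other by transposition). -/
noncomputable def interpolatedMatrixNorm (θ : ℝ) (n : ℕ) (x : Matrix (Fin n) (Fin n) EllTwo) :
    ℝ≥0∞ :=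
  complexInterpolationNorm (X := Fin n → Fin n → EllTwo)
    (fun y => concreteMatrixNorm columnEmbedding n (Matrix.of y))
    (fun y => concreteMatrixNorm rowEmbedding n (Matrix.of y)) θ x

/-! Both sides are compared with one quantity: for `x ∈ M_n(ℓ₂)`, the supremum of `∑ s_i^θ t_j^(1-θ)
‖(U x W)_ij‖²` over unitaries `U`, `W` and probability vectors `s`, `t`.

The hypothesis on `u` bounds this quantity by `C²` at the image of the unit ball of `M_n(E)`
(`sum_weighted_norm_sq_le`). By weighted AM-GM each summand is at most `C² (θ s_i g(x_ij x_ij*) +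
(1-θ) t_j f(x_ij* x_ij))`, and `∑_j x_ij x_ij*`, `∑_i x_ij* x_ij` are diagonal entries of `x x*`,
`x* x`. The unitaries do no harm, since `u` commutes with scalar products and these preserve the
norm of `M_n(E)`.

The interpolation norm is in turn at most the square root of the supremum
(`interpolatedMatrixNorm_le`), shown with an explicit function on the strip instead of duality. By
compactness there is a maximizer; let `y = U x W` and let `m` be the maximum. For fixed `U`, `s`,
optimality in `W`, `t` is the equality case of Hölder's inequality between the Schatten classes of
exponents `1/θ` and `1/(1-θ)`: the Gram matrix of the columns of `y`, weighted by `s^θ`, must be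
diagonal with entries `m t_j^θ` (`posDef_eq_diagonal_of_forall_le`). Symmetrically, the rows
weighted by `t^(1-θ)` are orthogonal with squared norms `m s_i^(1-θ)`. Hence `z ↦ s^((θ-z)/2) y
t^((z-θ)/2)`, with `s`, `t` as diagonal matrices, equals `y` at `θ`, has column norm at most `√m` on
`Re z = 0` and row norm at most `√m` on `Re z = 1`.

Two perturbations are removed in a limit: an `ε` added to the squared norms, which makes all weights
positive, and a Gaussian factor, which gives decay at infinity. -/

/-- The product `U x V` of a matrix `x` with entries in a module with scalar matrices. -/
noncomputable def sandwich {n : ℕ} {V : Type*} [AddCommGroup V] [Module ℂ V]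
    (U : Matrix (Fin n) (Fin n) ℂ) (x : Matrix (Fin n) (Fin n) V)
    (W : Matrix (Fin n) (Fin n) ℂ) : Matrix (Fin n) (Fin n) V :=
  Matrix.of fun i j => ∑ k, ∑ l, (U i k * W l j) • x k l

/-! ### Products with scalar matrices on both sides -/

section Sandwich

variable {n : ℕ} {V V' : Type*} [AddCommGroup V] [Module ℂ V] [AddCommGroup V'] [Module ℂ V']

theorem sandwich_apply (U : Matrix (Fin n) (Fin n) ℂ) (x : Matrix (Fin n) (Fin n) V)
    (W : Matrix (Fin n) (Fin n) ℂ) (i j : Fin n) :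
    sandwich U x W i j = ∑ k, ∑ l, (U i k * W l j) • x k l := rfl

theorem sandwich_one_left_apply (x : Matrix (Fin n) (Fin n) V)
    (W : Matrix (Fin n) (Fin n) ℂ) (i j : Fin n) :
    sandwich 1 x W i j = ∑ l, W l j • x i l := by
  rw [sandwich_apply, Finset.sum_eq_single i]
  · simp
  · intro b _ hb; simp [Matrix.one_apply_ne' hb]
  · simp

theorem sandwich_one_right_apply (U : Matrix (Fin n) (Fin n) ℂ)
    (x : Matrix (Fin n) (Fin n) V) (i j : Fin n) :
    sandwich U x 1 i j = ∑ k, U i k • x k j := by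
  rw [sandwich_apply]
  refine Finset.sum_congr rfl fun k _ => ?_
  rw [Finset.sum_eq_single j]
  · simp
  · intro b _ hb; simp [Matrix.one_apply_ne hb]
  · simp

theorem sandwich_one_one (x : Matrix (Fin n) (Fin n) V) : sandwich 1 x 1 = x := by
  ext i j
  rw [sandwich_one_left_apply, Finset.sum_eq_single j]
  · simp
  · intro b _ hb; simp [Matrix.one_apply_ne hb]
  · simp

theorem sandwich_sandwich (U U' W W' : Matrix (Fin n) (Fin n) ℂ)
    (x : Matrix (Fin n) (Fin n) V) :
    sandwich U (sandwich U' x W') W = sandwich (U * U') x (W' * W) := by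
  ext i j
  simp only [sandwich_apply, Matrix.mul_apply, Finset.sum_mul, Finset.mul_sum, Finset.sum_smul,
    Finset.smul_sum, smul_smul]
  calc _ = ∑ a, ∑ k, ∑ b, ∑ l, (U i a * W b j * (U' a k * W' l b)) • x k l := by
        refine Finset.sum_congr rfl fun a _ => ?_
        exact Finset.sum_comm
    _ = ∑ k, ∑ a, ∑ l, ∑ b, (U i a * W b j * (U' a k * W' l b)) • x k l := by
        rw [Finset.sum_comm]
        refine Finset.sum_congr rfl fun a _ => Finset.sum_congr rfl fun k _ => ?_
        exact Finset.sum_comm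
    _ = _ := by
        refine Finset.sum_congr rfl fun k _ => ?_
        rw [Finset.sum_comm]
        refine Finset.sum_congr rfl fun l _ => ?_
        rw [Finset.sum_comm]
        refine Finset.sum_congr rfl fun b _ => Finset.sum_congr rfl fun a _ => ?_
        congr 1
        ring

theorem sandwich_map (u : V →ₗ[ℂ] V') (U W : Matrix (Fin n) (Fin n) ℂ)
    (x : Matrix (Fin n) (Fin n) V) : (sandwich U x W).map u = sandwich U (x.map u) W := by
  ext i j
  simp [sandwich_apply]

end Sandwich

/-! ### Unitary invariance of matrix norms and diagonal matrices -/

section Unitary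

open CStarMatrix

variable {n : ℕ} {B : Type*} [NonUnitalCStarAlgebra B] [PartialOrder B] [StarOrderedRing B]

/-- Since `U* U = 1`, `(U x)* (U x) = x* x`, and the C*-identity concludes. This avoids viewing `U`
as a matrix over `B`, which may have no unit. -/
theorem norm_sandwich_left (U : Matrix (Fin n) (Fin n) ℂ) (hU : U ∈ Matrix.unitaryGroup (Fin n) ℂ)
    (x : Matrix (Fin n) (Fin n) B) : ‖ofMatrix (sandwich U x 1)‖ = ‖ofMatrix x‖ := by
  have h : star (ofMatrix (sandwich U x 1)) * ofMatrix (sandwich U x 1)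
      = star (ofMatrix x) * ofMatrix x := by
    ext i j
    simp only [CStarMatrix.mul_apply, CStarMatrix.star_apply, ofMatrix_apply,
      sandwich_one_right_apply, star_sum, star_smul, Finset.sum_mul_sum, smul_mul_smul_comm]
    rw [Finset.sum_comm]
    refine Finset.sum_congr rfl fun k _ => ?_
    rw [Finset.sum_comm]
    have hkl (l : Fin n) : ∑ a, star (U a k) * U a l = if k = l then 1 else 0 := by
      have := congrFun (congrFun (Matrix.mem_unitaryGroup_iff'.1 hU) k) l
      simpa [Matrix.mul_apply, Matrix.one_apply] using this
    simp only [← Finset.sum_smul, hkl, ite_smul, one_smul, zero_smul, Finset.sum_ite_eq,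
      Finset.mem_univ, if_true]
  have := CStarRing.norm_star_mul_self (x := ofMatrix (sandwich U x 1))
  rw [h, CStarRing.norm_star_mul_self] at this
  exact ((mul_self_inj (norm_nonneg _) (norm_nonneg _)).1 this).symm

theorem norm_sandwich_right (W : Matrix (Fin n) (Fin n) ℂ)
    (hW : W ∈ Matrix.unitaryGroup (Fin n) ℂ)
    (x : Matrix (Fin n) (Fin n) B) : ‖ofMatrix (sandwich 1 x W)‖ = ‖ofMatrix x‖ := by
  have h : ofMatrix (sandwich 1 x W) * star (ofMatrix (sandwich 1 x W))
      = ofMatrix x * star (ofMatrix x) := by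
    ext i j
    simp only [CStarMatrix.mul_apply, CStarMatrix.star_apply, ofMatrix_apply,
      sandwich_one_left_apply, star_sum, star_smul, Finset.sum_mul_sum, smul_mul_smul_comm]
    rw [Finset.sum_comm]
    refine Finset.sum_congr rfl fun k _ => ?_
    rw [Finset.sum_comm]
    have hkl (l : Fin n) : ∑ a, W k a * star (W l a) = if k = l then 1 else 0 := by
      have := congrFun (congrFun (Matrix.mem_unitaryGroup_iff.1 hW) k) l
      simpa [Matrix.mul_apply, Matrix.one_apply] using this
    simp only [← Finset.sum_smul, hkl, ite_smul, one_smul, zero_smul, Finset.sum_ite_eq,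
      Finset.mem_univ, if_true]
  have := CStarRing.norm_self_mul_star (x := ofMatrix (sandwich 1 x W))
  rw [h, CStarRing.norm_self_mul_star] at this
  exact ((mul_self_inj (norm_nonneg _) (norm_nonneg _)).1 this).symm

theorem norm_sandwich (U W : Matrix (Fin n) (Fin n) ℂ) (hU : U ∈ Matrix.unitaryGroup (Fin n) ℂ)
    (hW : W ∈ Matrix.unitaryGroup (Fin n) ℂ)
    (x : Matrix (Fin n) (Fin n) B) : ‖ofMatrix (sandwich U x W)‖ = ‖ofMatrix x‖ := by
  have : sandwich U x W = sandwich U (sandwich 1 x W) 1 := by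
    rw [sandwich_sandwich, mul_one, mul_one]
  rw [this, norm_sandwich_left U hU, norm_sandwich_right W hW]

theorem concreteMatrixNorm_sandwich {V : Type*} [AddCommGroup V] [Module ℂ V] (ι : V →ₗ[ℂ] B)
    (U W : Matrix (Fin n) (Fin n) ℂ) (hU : U ∈ Matrix.unitaryGroup (Fin n) ℂ)
    (hW : W ∈ Matrix.unitaryGroup (Fin n) ℂ) (x : Matrix (Fin n) (Fin n) V) :
    concreteMatrixNorm ι n (sandwich U x W) = concreteMatrixNorm ι n x := by
  rw [concreteMatrixNorm, concreteMatrixNorm, sandwich_map, ← ofReal_norm, norm_sandwich U W hU hW,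
    ofReal_norm]

/-- The diagonal embedding of `Bⁿ` into `M_n(B)`. -/
def diagonalHom (n : ℕ) (B : Type*) [NonUnitalCStarAlgebra B] :
    (Fin n → B) →⋆ₙₐ[ℂ] CStarMatrix (Fin n) (Fin n) B where
  toFun d := ofMatrix (Matrix.diagonal d)
  map_smul' c d := by
    ext i j; by_cases h : i = j <;> simp [Matrix.diagonal, h]
  map_zero' := by ext i j; simp
  map_add' c d := by ext i j; by_cases h : i = j <;> simp [Matrix.diagonal, h]
  map_mul' c d := by
    ext i j
    by_cases h : i = j <;> simp [Matrix.diagonal, h, CStarMatrix.mul_apply]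
  map_star' d := by
    ext i j
    by_cases h : i = j
    · subst h; simp [Matrix.diagonal, CStarMatrix.star_apply]
    · simp [Matrix.diagonal, CStarMatrix.star_apply, h, Ne.symm h]

theorem norm_diagonal_le {d : Fin n → B} {K : ℝ} (hK : 0 ≤ K) (hd : ∀ i, ‖d i‖ ≤ K) :
    ‖ofMatrix (Matrix.diagonal d)‖ ≤ K :=
  (NonUnitalStarAlgHom.norm_apply_le (diagonalHom n B) d).trans ((pi_norm_le_iff_of_nonneg hK).2 hd)

end Unitary

/-! ### Column and row norms of matrices with orthogonal columns or rows -/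

section ColumnRow

open CStarMatrix

variable {n : ℕ}

theorem EllTwo.norm_e₀ : ‖EllTwo.e₀‖ = 1 := by
  simp [EllTwo.e₀]

theorem EllTwo.inner_star_star (x y : EllTwo) : ⟪star x, star y⟫_ℂ = ⟪y, x⟫_ℂ := by
  rw [lp.inner_eq_tsum, lp.inner_eq_tsum]
  exact tsum_congr fun i => by simp [mul_comm]

theorem norm_diagonal_rankOne_le {r : Fin n → ℝ} {K : ℝ} (hr : ∀ j, 0 ≤ r j)
    (hK : ∀ j, r j ≤ K ^ 2) :
    ‖ofMatrix (Matrix.diagonal fun j => (r j : ℂ) •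
      InnerProductSpace.rankOne ℂ EllTwo.e₀ EllTwo.e₀)‖ ≤ K ^ 2 := by
  refine norm_diagonal_le (sq_nonneg K) fun j => ?_
  rw [norm_smul, InnerProductSpace.norm_rankOne, EllTwo.norm_e₀, Complex.norm_real,
    Real.norm_of_nonneg (hr j)]
  simpa using hK j

/-- In `M_n(C)` the matrix `y* y` is the Gram matrix of the columns of `y` times the projection onto
`e₀`. Orthogonality makes it diagonal, so its norm is controlled entry by entry. -/
theorem columnMatrixNorm_le {y : Matrix (Fin n) (Fin n) EllTwo} {K : ℝ} (hK : 0 ≤ K)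
    (horth : ∀ j l, j ≠ l → ∑ i, ⟪y i j, y i l⟫_ℂ = 0) (hdiag : ∀ j, ∑ i, ‖y i j‖ ^ 2 ≤ K ^ 2) :
    concreteMatrixNorm columnEmbedding n y ≤ ENNReal.ofReal K := by
  rw [concreteMatrixNorm, ← ofReal_norm]
  refine ENNReal.ofReal_le_ofReal (le_of_sq_le_sq ?_ hK)
  rw [sq, ← CStarRing.norm_star_mul_self]
  have : star (ofMatrix (y.map columnEmbedding)) * ofMatrix (y.map columnEmbedding) =
      ofMatrix (Matrix.diagonal fun j => ((∑ i, ‖y i j‖ ^ 2 : ℝ) : ℂ) •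
        InnerProductSpace.rankOne ℂ EllTwo.e₀ EllTwo.e₀) := by
    ext1 j l
    have h : (∑ i, ⟪y i j, y i l⟫_ℂ) =
        if j = l then ((∑ i, ‖y i j‖ ^ 2 : ℝ) : ℂ) else 0 := by
      split_ifs with h
      · subst h; simp [inner_self_eq_norm_sq_to_K]
      · exact horth j l h
    simp only [CStarMatrix.mul_apply, CStarMatrix.star_apply, ofMatrix_apply, Matrix.map_apply,
      columnEmbedding, LinearMap.coe_mk, AddHom.coe_mk, ContinuousLinearMap.star_eq_adjoint,
      InnerProductSpace.adjoint_rankOne, ContinuousLinearMap.mul_def,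
      InnerProductSpace.rankOne_comp_rankOne, ← Finset.sum_smul, h, Matrix.diagonal_apply, ite_smul,
      zero_smul]
  rw [this]
  exact norm_diagonal_rankOne_le (fun j => by positivity) hdiag

theorem rowMatrixNorm_le {y : Matrix (Fin n) (Fin n) EllTwo} {K : ℝ} (hK : 0 ≤ K)
    (horth : ∀ i l, i ≠ l → ∑ j, ⟪y i j, y l j⟫_ℂ = 0) (hdiag : ∀ i, ∑ j, ‖y i j‖ ^ 2 ≤ K ^ 2) :
    concreteMatrixNorm rowEmbedding n y ≤ ENNReal.ofReal K := by
  rw [concreteMatrixNorm, ← ofReal_norm]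
  refine ENNReal.ofReal_le_ofReal (le_of_sq_le_sq ?_ hK)
  rw [sq, ← CStarRing.norm_self_mul_star]
  have : ofMatrix (y.map rowEmbedding) * star (ofMatrix (y.map rowEmbedding)) =
      ofMatrix (Matrix.diagonal fun i => ((∑ j, ‖y i j‖ ^ 2 : ℝ) : ℂ) •
        InnerProductSpace.rankOne ℂ EllTwo.e₀ EllTwo.e₀) := by
    ext1 i l
    have h : (∑ j, ⟪y l j, y i j⟫_ℂ) =
        if i = l then ((∑ j, ‖y i j‖ ^ 2 : ℝ) : ℂ) else 0 := by
      split_ifs with h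
      · subst h; simp [inner_self_eq_norm_sq_to_K]
      · exact horth l i (Ne.symm h)
    simp only [CStarMatrix.mul_apply, CStarMatrix.star_apply, ofMatrix_apply, Matrix.map_apply,
      rowEmbedding, LinearMap.coe_mk, AddHom.coe_mk, ContinuousLinearMap.star_eq_adjoint,
      InnerProductSpace.adjoint_rankOne, ContinuousLinearMap.mul_def, EllTwo.inner_star_star,
      InnerProductSpace.rankOne_comp_rankOne, ← Finset.sum_smul, h, Matrix.diagonal_apply, ite_smul,
      zero_smul]
  rw [this]
  exact norm_diagonal_rankOne_le (fun j => by positivity) hdiag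

end ColumnRow

/-! ### The equality case of Hölder's inequality for positive matrices -/

theorem Real.eq_of_rpow_mul_rpow_eq {θ a b : ℝ} (hθ0 : 0 < θ) (hθ1 : θ < 1) (ha : 0 ≤ a)
    (hb : 0 ≤ b) (h : a ^ θ * b ^ (1 - θ) = θ * a + (1 - θ) * b) : a = b := by
  have := Real.geom_mean_eq_arith_mean_weighted_iff_of_pos Finset.univ ![θ, 1 - θ] ![a, b]
    (by simp [Fin.forall_fin_two, hθ0, hθ1]) (by simp) (by simp [Fin.forall_fin_two, ha, hb])
  simp only [Fin.prod_univ_two, Fin.sum_univ_two, Matrix.cons_val_zero, Matrix.cons_val_one] at this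
  exact this.1 h 0 (Finset.mem_univ _) 1 (Finset.mem_univ _)

theorem Real.rpow_mul_rpow_le_weighted {θ a b : ℝ} (hθ0 : 0 < θ) (hθ1 : θ < 1) (ha : 0 ≤ a)
    (hb : 0 ≤ b) : a ^ θ * b ^ (1 - θ) ≤ θ * a + (1 - θ) * b :=
  Real.geom_mean_le_arith_mean2_weighted hθ0.le (by linarith) ha hb (by ring)

/-- If `a` and `b` are probability vectors and `c` is doubly stochastic, then equality in
`∑ c j k (a k) ^ θ (b j) ^ (1 - θ) ≤ 1` forces `a k = b j` wherever `c j k ≠ 0`. -/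
theorem eq_of_one_le_sum_rpow {n : ℕ} {θ : ℝ} (hθ0 : 0 < θ) (hθ1 : θ < 1) {a b : Fin n → ℝ}
    (ha : a ∈ stdSimplex ℝ (Fin n)) (hb : b ∈ stdSimplex ℝ (Fin n)) {c : Fin n → Fin n → ℝ}
    (hc : ∀ j k, 0 ≤ c j k) (hrow : ∀ j, ∑ k, c j k = 1) (hcol : ∀ k, ∑ j, c j k = 1)
    (h : 1 ≤ ∑ j, ∑ k, c j k * (a k ^ θ * b j ^ (1 - θ))) (j k : Fin n) (hjk : c j k ≠ 0) :
    a k = b j := by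
  have hle : ∀ j k, c j k * (a k ^ θ * b j ^ (1 - θ)) ≤ c j k * (θ * a k + (1 - θ) * b j) :=
    fun j k => mul_le_mul_of_nonneg_left
      (Real.rpow_mul_rpow_le_weighted hθ0 hθ1 (ha.1 k) (hb.1 j)) (hc j k)
  have hsum : ∑ j, ∑ k, c j k * (θ * a k + (1 - θ) * b j) = 1 := by
    have h1 : ∑ j, ∑ k, c j k * a k = 1 := by
      rw [Finset.sum_comm]; simp [← Finset.sum_mul, hcol, ha.2]
    have h2 : ∑ j, ∑ k, c j k * b j = 1 := by simp [← Finset.sum_mul, hrow, hb.2]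
    calc _ = θ * ∑ j, ∑ k, c j k * a k + (1 - θ) * ∑ j, ∑ k, c j k * b j := by
          simp only [Finset.mul_sum, ← Finset.sum_add_distrib]
          exact Finset.sum_congr rfl fun j _ => Finset.sum_congr rfl fun k _ => by ring
      _ = 1 := by rw [h1, h2]; ring
  -- AM-GM holds term by term and the arithmetic means sum to 1, so the hypothesis forces equality
  -- in every term.
  have heq : ∑ j, ∑ k, c j k * (a k ^ θ * b j ^ (1 - θ)) =
      ∑ j, ∑ k, c j k * (θ * a k + (1 - θ) * b j) :=
    le_antisymm (Finset.sum_le_sum fun j _ => Finset.sum_le_sum fun k _ => hle j k)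
      (hsum.trans_le h)
  have hj := (Finset.sum_eq_sum_iff_of_le fun j _ => Finset.sum_le_sum fun k _ => hle j k).1 heq j
    (Finset.mem_univ _)
  have hk := (Finset.sum_eq_sum_iff_of_le fun k _ => hle j k).1 hj k (Finset.mem_univ _)
  exact Real.eq_of_rpow_mul_rpow_eq hθ0 hθ1 (ha.1 k) (hb.1 j) (mul_left_cancel₀ hjk hk)

/-- A positive definite matrix `T` for which the identity and `t` maximize
`∑ j, (t j) ^ (1 - θ) * (Wᴴ T W) j j` over unitary `W` and probability vectors `t` is the diagonal
matrix with entries proportional to `t ^ θ`. -/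
theorem posDef_eq_diagonal_of_forall_le {n : ℕ} {θ : ℝ} (hθ0 : 0 < θ) (hθ1 : θ < 1)
    {T : Matrix (Fin n) (Fin n) ℂ} (hT : T.PosDef) {t : Fin n → ℝ}
    (ht : t ∈ stdSimplex ℝ (Fin n))
    (hmax : ∀ W ∈ Matrix.unitaryGroup (Fin n) ℂ, ∀ t' ∈ stdSimplex ℝ (Fin n),
      ∑ j, t' j ^ (1 - θ) * ((star W * T * W) j j).re ≤ ∑ j, t j ^ (1 - θ) * (T j j).re) :
    (∀ j, 0 < t j) ∧ ∀ j l, T j l =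
      if j = l then (((∑ k, t k ^ (1 - θ) * (T k k).re) * t j ^ θ : ℝ) : ℂ) else 0 := by
  set lam := ∑ k, t k ^ (1 - θ) * (T k k).re with hlam
  set W : Matrix (Fin n) (Fin n) ℂ :=
    (hT.1.eigenvectorUnitary : Matrix (Fin n) (Fin n) ℂ) with hW
  have hWmem : W ∈ Matrix.unitaryGroup (Fin n) ℂ := hT.1.eigenvectorUnitary.2
  set μ := hT.1.eigenvalues with hμ
  have hμpos : ∀ k, 0 < μ k := hT.eigenvalues_pos
  have hspec : T = W * Matrix.diagonal (fun k => (μ k : ℂ)) * star W := hT.1.spectral_theorem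
  have hWW : star W * W = 1 := Matrix.mem_unitaryGroup_iff'.1 hWmem
  have hWW' : W * star W = 1 := Matrix.mem_unitaryGroup_iff.1 hWmem
  have hdiag : star W * T * W = Matrix.diagonal (fun k => (μ k : ℂ)) := by
    rw [hspec]
    calc _ = (star W * W) * Matrix.diagonal (fun k => (μ k : ℂ)) * (star W * W) := by
          simp only [mul_assoc]
      _ = _ := by rw [hWW, one_mul, mul_one]
  have hne : (Finset.univ : Finset (Fin n)).Nonempty := by
    by_contra h
    have h2 := ht.2
    rw [Finset.not_nonempty_iff_eq_empty] at h
    rw [h] at h2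
    simp at h2
  set S := ∑ k, μ k ^ (1 / θ) with hS
  have hSpos : 0 < S := Finset.sum_pos (fun k _ => Real.rpow_pos_of_pos (hμpos k) _) hne
  -- `L` is the Schatten norm of `T` of exponent `1/θ`, and `p` is the probability vector with `μ =
  -- L p^θ`, extremal in Hölder's inequality.
  set L := S ^ θ
  have hL : 0 < L := Real.rpow_pos_of_pos hSpos _
  set p : Fin n → ℝ := fun k => μ k ^ (1 / θ) / S with hp
  have hppos : ∀ k, 0 < p k := fun k => div_pos (Real.rpow_pos_of_pos (hμpos k) _) hSpos
  have hpmem : p ∈ stdSimplex ℝ (Fin n) :=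
    ⟨fun k => (hppos k).le, by rw [hp, ← Finset.sum_div, div_self hSpos.ne']⟩
  have hμp : ∀ k, μ k = L * p k ^ θ := fun k => by
    rw [← Real.mul_rpow hSpos.le (hppos k).le]
    rw [hp]
    simp only
    rw [mul_div_cancel₀ _ hSpos.ne', ← Real.rpow_mul (hμpos k).le, one_div_mul_cancel hθ0.ne',
      Real.rpow_one]
  -- The competitor is the eigenbasis of `T` together with `p`; its value is `L ∑ p_k = L`.
  have hLle : L ≤ lam := by
    have := hmax W hWmem p hpmem
    rw [hdiag] at this
    refine le_trans (le_of_eq ?_) this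
    calc L = L * ∑ k, p k := by rw [hpmem.2, mul_one]
      _ = _ := by
        rw [Finset.mul_sum]
        refine Finset.sum_congr rfl fun k _ => ?_
        rw [Matrix.diagonal_apply_eq, Complex.ofReal_re, hμp]
        conv_lhs => rw [← Real.rpow_one (p k), show (1 : ℝ) = (1 - θ) + θ by ring,
          Real.rpow_add (hppos k)]
        ring
  have hTjl : ∀ j l, T j l = ∑ k, W j k * (μ k : ℂ) * star (W l k) := fun j l => by
    conv_lhs => rw [hspec]
    simp [Matrix.mul_apply, Matrix.diagonal_apply, Matrix.star_apply]
  -- The squared moduli of the entries of a unitary form a doubly stochastic matrix.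
  set c : Fin n → Fin n → ℝ := fun j k => ‖W j k‖ ^ 2 with hc
  have hTjj : ∀ j, (T j j).re = ∑ k, c j k * μ k := fun j => by
    rw [hTjl, Complex.re_sum]
    refine Finset.sum_congr rfl fun k _ => ?_
    have : W j k * (μ k : ℂ) * star (W j k) = ((‖W j k‖ ^ 2 * μ k : ℝ) : ℂ) := by
      push_cast
      rw [← Complex.mul_conj']
      simp only [RCLike.star_def]
      ring
    rw [this, Complex.ofReal_re]
  have hnorm : ∀ z : ℂ, ((‖z‖ ^ 2 : ℝ) : ℂ) = z * star z := fun z => by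
    push_cast
    rw [← Complex.mul_conj']; rfl
  have hrow : ∀ j, ∑ k, c j k = 1 := fun j => by
    have := congrFun (congrFun hWW' j) j
    rw [Matrix.mul_apply, Matrix.one_apply_eq] at this
    apply Complex.ofReal_injective
    rw [Complex.ofReal_sum, Complex.ofReal_one, ← this]
    exact Finset.sum_congr rfl fun k _ => hnorm _
  have hcol : ∀ k, ∑ j, c j k = 1 := fun k => by
    have := congrFun (congrFun hWW k) k
    rw [Matrix.mul_apply, Matrix.one_apply_eq] at this
    apply Complex.ofReal_injective
    rw [Complex.ofReal_sum, Complex.ofReal_one, ← this]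
    exact Finset.sum_congr rfl fun j _ => (hnorm _).trans (mul_comm _ _)
  have hlam2 : lam = L * ∑ j, ∑ k, c j k * (p k ^ θ * t j ^ (1 - θ)) := by
    rw [hlam, Finset.mul_sum]
    refine Finset.sum_congr rfl fun j _ => ?_
    rw [hTjj, Finset.mul_sum, Finset.mul_sum]
    refine Finset.sum_congr rfl fun k _ => ?_
    rw [hμp]; ring
  have hone : 1 ≤ ∑ j, ∑ k, c j k * (p k ^ θ * t j ^ (1 - θ)) := by
    rw [hlam2] at hLle
    exact (le_mul_iff_one_le_right hL).1 hLle
  have hpt : ∀ j k, W j k ≠ 0 → p k = t j := fun j k hjk =>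
    eq_of_one_le_sum_rpow hθ0 hθ1 hpmem ht (fun j k => sq_nonneg _) hrow hcol hone j k
      (by simpa [hc] using hjk)
  -- Wherever `W j k ≠ 0` the eigenvalue `μ k` equals `L t_j^θ`, which depends on `j` only; it
  -- leaves the sum, and `W W* = 1` remains.
  have hTeq : ∀ j l, T j l = if j = l then ((L * t j ^ θ : ℝ) : ℂ) else 0 := fun j l => by
    rw [hTjl]
    have : ∀ k, W j k * (μ k : ℂ) * star (W l k) =
        ((L * t j ^ θ : ℝ) : ℂ) * (W j k * star (W l k)) := fun k => by
      by_cases h : W j k = 0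
      · simp [h]
      · rw [hμp, hpt j k h]; ring
    simp only [this, ← Finset.mul_sum]
    have h1 := congrFun (congrFun hWW' j) l
    rw [Matrix.mul_apply, Matrix.one_apply] at h1
    simp only [Matrix.star_apply] at h1
    rw [h1]; simp
  have htpos : ∀ j, 0 < t j := fun j => by
    have : ∃ k, W j k ≠ 0 := by
      by_contra! h
      have := hrow j
      simp [hc, h] at this
    obtain ⟨k, hk⟩ := this
    exact hpt j k hk ▸ hppos k
  have hlamL : lam = L := by
    rw [hlam]
    calc _ = ∑ k, L * t k := by
          refine Finset.sum_congr rfl fun k _ => ?_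
          rw [hTeq, if_pos rfl, Complex.ofReal_re]
          conv_rhs => rw [← Real.rpow_one (t k), show (1 : ℝ) = (1 - θ) + θ by ring,
            Real.rpow_add (htpos k)]
          ring
      _ = L := by rw [← Finset.mul_sum, ht.2, mul_one]
  exact ⟨htpos, hlamL ▸ hTeq⟩

/-! ### Weighted Gram matrices -/

/-- The weighted Gram matrix of the columns of `y`, regularized by `ε`. -/
noncomputable def columnGram {n : ℕ} {H : Type*} [NormedAddCommGroup H] [InnerProductSpace ℂ H]
    (w : Fin n → ℝ) (ε : ℝ) (y : Matrix (Fin n) (Fin n) H) : Matrix (Fin n) (Fin n) ℂ :=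
  Matrix.of fun j l => ∑ i, (w i : ℂ) * (⟪y i j, y i l⟫_ℂ + if j = l then (ε : ℂ) else 0)

section Gram

variable {n : ℕ} {H : Type*} [NormedAddCommGroup H] [InnerProductSpace ℂ H]

/-- Used twice: for definiteness, and with `v` a column of a unitary to read off the diagonal of `W*
T W`. -/
theorem star_dotProduct_columnGram (w : Fin n → ℝ) (ε : ℝ) (y : Matrix (Fin n) (Fin n) H)
    (v : Fin n → ℂ) : ∑ j, ∑ l, star (v j) * columnGram w ε y j l * v l =
      ((∑ i, w i * (‖∑ l, v l • y i l‖ ^ 2 + ε * ∑ j, ‖v j‖ ^ 2) : ℝ) : ℂ) := by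
  have h1 : ∀ i, ((‖∑ l, v l • y i l‖ ^ 2 : ℝ) : ℂ) =
      ∑ j, ∑ l, star (v j) * ⟪y i j, y i l⟫_ℂ * v l := fun i => by
    have := inner_self_eq_norm_sq_to_K (𝕜 := ℂ) (∑ l, v l • y i l)
    rw [sum_inner] at this
    simp only [inner_sum, inner_smul_left, inner_smul_right] at this
    push_cast
    refine this.symm.trans (Finset.sum_congr rfl fun j _ => Finset.sum_congr rfl fun l _ => ?_)
    simp only [RCLike.star_def]; ring
  have h2 : ((∑ j, ‖v j‖ ^ 2 : ℝ) : ℂ) =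
      ∑ j, ∑ l, star (v j) * (if j = l then (1 : ℂ) else 0) * v l := by
    rw [Complex.ofReal_sum]
    refine Finset.sum_congr rfl fun j _ => ?_
    simp only [mul_ite, mul_one, mul_zero, ite_mul, zero_mul, Finset.sum_ite_eq, Finset.mem_univ,
      if_true]
    push_cast
    exact (Complex.conj_mul' _).symm
  rw [Complex.ofReal_sum]
  simp only [Complex.ofReal_mul, Complex.ofReal_add, h1, h2]
  simp only [columnGram, Matrix.of_apply, Finset.mul_sum, Finset.sum_mul,
    ← Finset.sum_add_distrib]
  symm
  rw [Finset.sum_comm]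
  refine Finset.sum_congr rfl fun j _ => ?_
  rw [Finset.sum_comm]
  refine Finset.sum_congr rfl fun l _ => Finset.sum_congr rfl fun i _ => ?_
  split_ifs <;> ring

/-- The `ε` gives definiteness even when the columns of `y` are dependent. The positive eigenvalues
later make every weight `t_j` positive, as logarithms and negative powers of it require. -/
theorem columnGram_posDef {w : Fin n → ℝ} (hw : ∀ i, 0 ≤ w i) (hw' : 0 < ∑ i, w i) {ε : ℝ}
    (hε : 0 < ε) (y : Matrix (Fin n) (Fin n) H) : (columnGram w ε y).PosDef := by
  refine Matrix.PosDef.of_dotProduct_mulVec_pos ?_ fun v hv => ?_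
  · ext j l
    simp only [columnGram, Matrix.conjTranspose_apply, Matrix.of_apply, star_sum, star_mul',
      star_add, RCLike.star_def, Complex.conj_ofReal, inner_conj_symm, eq_comm (a := l)]
    split_ifs <;> simp
  · have h : star v ⬝ᵥ (columnGram w ε y).mulVec v =
        ∑ j, ∑ l, star (v j) * columnGram w ε y j l * v l := by
      simp [dotProduct, Matrix.mulVec, Finset.mul_sum, mul_assoc]
    rw [h, star_dotProduct_columnGram]
    refine Complex.zero_lt_real.2 ?_
    have hv' : 0 < ∑ j, ‖v j‖ ^ 2 := by
      obtain ⟨j, hj⟩ := Function.ne_iff.1 hv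
      exact Finset.sum_pos' (fun _ _ => sq_nonneg _)
        ⟨j, Finset.mem_univ _, pow_pos (norm_pos_iff.2 hj) 2⟩
    calc 0 < (∑ i, w i) * (ε * ∑ j, ‖v j‖ ^ 2) := by positivity
      _ ≤ _ := by
        rw [Finset.sum_mul]
        exact Finset.sum_le_sum fun i _ => mul_le_mul_of_nonneg_left
          (le_add_of_nonneg_left (sq_nonneg _)) (hw i)

theorem columnGram_conj_apply (w : Fin n → ℝ) (ε : ℝ) (y : Matrix (Fin n) (Fin n) H)
    {W : Matrix (Fin n) (Fin n) ℂ} (hW : W ∈ Matrix.unitaryGroup (Fin n) ℂ) (j : Fin n) :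
    ((star W * columnGram w ε y * W) j j).re = ∑ i, w i * (‖sandwich 1 y W i j‖ ^ 2 + ε) := by
  have h : (star W * columnGram w ε y * W) j j =
      ∑ k, ∑ l, star (W k j) * columnGram w ε y k l * W l j := by
    simp only [Matrix.mul_apply, Finset.sum_mul, Matrix.star_apply]
    exact Finset.sum_comm
  have hn : ∑ k, ‖W k j‖ ^ 2 = 1 := by
    have := congrFun (congrFun (Matrix.mem_unitaryGroup_iff'.1 hW) j) j
    rw [Matrix.mul_apply, Matrix.one_apply_eq] at this
    apply Complex.ofReal_injective
    rw [Complex.ofReal_sum, Complex.ofReal_one, ← this]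
    refine Finset.sum_congr rfl fun k _ => ?_
    push_cast
    exact (Complex.conj_mul' _).symm
  rw [h, star_dotProduct_columnGram w ε y fun l => W l j, Complex.ofReal_re]
  simp only [hn, mul_one, sandwich_one_left_apply]

theorem columnGram_apply_self_re (w : Fin n → ℝ) (ε : ℝ) (y : Matrix (Fin n) (Fin n) H)
    (j : Fin n) : (columnGram w ε y j j).re = ∑ i, w i * (‖y i j‖ ^ 2 + ε) := by
  have := columnGram_conj_apply w ε y (one_mem (Matrix.unitaryGroup (Fin n) ℂ)) j
  simpa [sandwich_one_one] using this

/-- The functional is `∑ t_j^(1-θ) T_jj` for the Gram matrix `T`, so its maximizers make `T`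
diagonal. The `ε` sits on the diagonal only: orthogonality is exact, while dropping `ε` turns the
diagonal identity into an inequality. -/
theorem orthogonal_columns_of_forall_le {θ : ℝ} (hθ0 : 0 < θ) (hθ1 : θ < 1)
    {w : Fin n → ℝ} (hw : ∀ i, 0 ≤ w i) (hw' : 0 < ∑ i, w i) {ε : ℝ} (hε : 0 < ε)
    (y : Matrix (Fin n) (Fin n) H) {t : Fin n → ℝ} (ht : t ∈ stdSimplex ℝ (Fin n))
    (hmax : ∀ W ∈ Matrix.unitaryGroup (Fin n) ℂ, ∀ t' ∈ stdSimplex ℝ (Fin n),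
      ∑ i, ∑ j, w i * t' j ^ (1 - θ) * (‖sandwich 1 y W i j‖ ^ 2 + ε) ≤
        ∑ i, ∑ j, w i * t j ^ (1 - θ) * (‖y i j‖ ^ 2 + ε)) :
    (∀ j, 0 < t j) ∧ (∀ j l, j ≠ l → ∑ i, (w i : ℂ) * ⟪y i j, y i l⟫_ℂ = 0) ∧
      ∀ j, ∑ i, w i * ‖y i j‖ ^ 2 ≤
        (∑ i, ∑ j, w i * t j ^ (1 - θ) * (‖y i j‖ ^ 2 + ε)) * t j ^ θ := by
  have hsum : ∀ (z : Matrix (Fin n) (Fin n) H) (t' : Fin n → ℝ),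
      ∑ i, ∑ j, w i * t' j ^ (1 - θ) * (‖z i j‖ ^ 2 + ε) =
        ∑ j, t' j ^ (1 - θ) * ∑ i, w i * (‖z i j‖ ^ 2 + ε) := fun z t' => by
    rw [Finset.sum_comm]
    refine Finset.sum_congr rfl fun j _ => ?_
    rw [Finset.mul_sum]
    exact Finset.sum_congr rfl fun i _ => by ring
  obtain ⟨h1, h2⟩ := posDef_eq_diagonal_of_forall_le hθ0 hθ1 (columnGram_posDef hw hw' hε y) ht
    (fun W hW t' ht' => by
      simp only [columnGram_conj_apply w ε y hW, columnGram_apply_self_re, ← hsum]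
      exact hmax W hW t' ht')
  simp only [columnGram_apply_self_re, ← hsum] at h2
  refine ⟨h1, fun j l hjl => ?_, fun j => ?_⟩
  · have := h2 j l
    simpa [columnGram, hjl] using this
  · have := congrArg Complex.re (h2 j j)
    rw [columnGram_apply_self_re, if_pos rfl, Complex.ofReal_re] at this
    rw [← this]
    exact Finset.sum_le_sum fun i _ => mul_le_mul_of_nonneg_left
      (le_add_of_nonneg_right hε.le) (hw i)

end Gram

/-! ### Existence of a maximizer and its orthogonality relations -/

theorem isCompact_unitaryGroup (n : ℕ) :
    IsCompact (Matrix.unitaryGroup (Fin n) ℂ : Set (Matrix (Fin n) (Fin n) ℂ)) := by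
  have hK : IsCompact (Set.univ.pi fun _ : Fin n => Set.univ.pi fun _ : Fin n =>
      Metric.closedBall (0 : ℂ) 1) :=
    isCompact_univ_pi fun _ => isCompact_univ_pi fun _ => isCompact_closedBall _ _
  refine IsCompact.of_isClosed_subset hK ?_ fun U hU => ?_
  · have : (Matrix.unitaryGroup (Fin n) ℂ : Set (Matrix (Fin n) (Fin n) ℂ)) =
        {U | U * star U = 1} := by
      ext U; exact Matrix.mem_unitaryGroup_iff
    rw [this]
    exact isClosed_eq (by fun_prop) continuous_const
  · exact fun i _ j _ => mem_closedBall_zero_iff.2 (entry_norm_bound_of_unitary hU i j)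

theorem transpose_mem_unitaryGroup {n : ℕ} {U : Matrix (Fin n) (Fin n) ℂ}
    (hU : U ∈ Matrix.unitaryGroup (Fin n) ℂ) :
    U.transpose ∈ Matrix.unitaryGroup (Fin n) ℂ := by
  have h : star U.transpose = (star U).transpose := rfl
  rw [Matrix.mem_unitaryGroup_iff, h, ← Matrix.transpose_mul, Matrix.mem_unitaryGroup_iff'.1 hU,
    Matrix.transpose_one]

section Maximizer

variable {n : ℕ} {H : Type*} [NormedAddCommGroup H] [InnerProductSpace ℂ H]

theorem exists_sandwich_maximizer [NeZero n] {θ : ℝ} (hθ0 : 0 < θ) (hθ1 : θ < 1) (ε : ℝ)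
    (x : Matrix (Fin n) (Fin n) H) :
    ∃ U ∈ Matrix.unitaryGroup (Fin n) ℂ, ∃ W ∈ Matrix.unitaryGroup (Fin n) ℂ,
    ∃ s ∈ stdSimplex ℝ (Fin n), ∃ t ∈ stdSimplex ℝ (Fin n),
      ∀ U' ∈ Matrix.unitaryGroup (Fin n) ℂ, ∀ W' ∈ Matrix.unitaryGroup (Fin n) ℂ,
      ∀ s' ∈ stdSimplex ℝ (Fin n), ∀ t' ∈ stdSimplex ℝ (Fin n),
        ∑ i, ∑ j, s' i ^ θ * t' j ^ (1 - θ) * (‖sandwich U' x W' i j‖ ^ 2 + ε) ≤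
          ∑ i, ∑ j, s i ^ θ * t j ^ (1 - θ) * (‖sandwich U x W i j‖ ^ 2 + ε) := by
  have hK := ((isCompact_unitaryGroup n).prod (isCompact_unitaryGroup n)).prod
    ((isCompact_stdSimplex ℝ (Fin n)).prod (isCompact_stdSimplex ℝ (Fin n)))
  have hne : ((((Matrix.unitaryGroup (Fin n) ℂ : Set (Matrix (Fin n) (Fin n) ℂ)) ×ˢ
      (Matrix.unitaryGroup (Fin n) ℂ : Set (Matrix (Fin n) (Fin n) ℂ))) ×ˢ
      (stdSimplex ℝ (Fin n) ×ˢ stdSimplex ℝ (Fin n)))).Nonempty :=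
    ⟨((1, 1), (Pi.single 0 1, Pi.single 0 1)), ⟨one_mem _, one_mem _⟩,
      single_mem_stdSimplex ℝ 0, single_mem_stdSimplex ℝ 0⟩
  obtain ⟨⟨⟨U, W⟩, ⟨s, t⟩⟩, ⟨⟨hU, hW⟩, ⟨hs, ht⟩⟩, hmax⟩ := hK.exists_isMaxOn hne
    (f := fun q => ∑ i, ∑ j, q.2.1 i ^ θ * q.2.2 j ^ (1 - θ) *
      (‖sandwich q.1.1 x q.1.2 i j‖ ^ 2 + ε)) (by
      refine Continuous.continuousOn ?_
      simp only [sandwich_apply]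
      refine continuous_finsetSum _ fun i _ => continuous_finsetSum _ fun j _ => ?_
      have h1 : Continuous fun q : (Matrix (Fin n) (Fin n) ℂ × Matrix (Fin n) (Fin n) ℂ) ×
          ((Fin n → ℝ) × (Fin n → ℝ)) => q.2.1 i ^ θ :=
        (Real.continuous_rpow_const hθ0.le).comp (by fun_prop)
      have h2 : Continuous fun q : (Matrix (Fin n) (Fin n) ℂ × Matrix (Fin n) (Fin n) ℂ) ×
          ((Fin n → ℝ) × (Fin n → ℝ)) => q.2.2 j ^ (1 - θ) :=
        (Real.continuous_rpow_const (by linarith)).comp (by fun_prop)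
      have h3 : Continuous fun q : (Matrix (Fin n) (Fin n) ℂ × Matrix (Fin n) (Fin n) ℂ) ×
          ((Fin n → ℝ) × (Fin n → ℝ)) => ∑ k, ∑ l, (q.1.1 i k * q.1.2 l j) • x k l := by
        refine continuous_finsetSum _ fun k _ => continuous_finsetSum _ fun l _ => ?_
        refine Continuous.smul ?_ continuous_const
        exact (continuous_fst.fst.matrix_elem i k).mul (continuous_fst.snd.matrix_elem l j)
      exact (h1.mul h2).mul ((h3.norm.pow 2).add continuous_const))
  exact ⟨U, hU, W, hW, s, hs, t, ht, fun U' hU' W' hW' s' hs' t' ht' =>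
    hmax (a := ((U', W'), (s', t'))) ⟨⟨hU', hW'⟩, ⟨hs', ht'⟩⟩⟩

theorem sum_rpow_pos_of_mem_stdSimplex (r : ℝ) {s : Fin n → ℝ} (hs : s ∈ stdSimplex ℝ (Fin n)) :
    0 < ∑ i, s i ^ r := by
  obtain ⟨i, hi⟩ : ∃ i, s i ≠ 0 := by
    by_contra! h
    have := hs.2
    simp [h] at this
  exact Finset.sum_pos' (fun i _ => Real.rpow_nonneg (hs.1 i) _)
    ⟨i, Finset.mem_univ _, Real.rpow_pos_of_pos ((hs.1 i).lt_of_ne hi.symm) _⟩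

theorem exists_sandwich_orthogonal [NeZero n] {θ : ℝ} (hθ0 : 0 < θ) (hθ1 : θ < 1) {ε : ℝ}
    (hε : 0 < ε) (x : Matrix (Fin n) (Fin n) H) :
    ∃ U ∈ Matrix.unitaryGroup (Fin n) ℂ, ∃ W ∈ Matrix.unitaryGroup (Fin n) ℂ,
    ∃ s ∈ stdSimplex ℝ (Fin n), ∃ t ∈ stdSimplex ℝ (Fin n), ∃ m : ℝ,
      m = ∑ i, ∑ j, s i ^ θ * t j ^ (1 - θ) * (‖sandwich U x W i j‖ ^ 2 + ε) ∧
      (∀ i, 0 < s i) ∧ (∀ j, 0 < t j) ∧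
      (∀ j l, j ≠ l →
        ∑ i, ((s i ^ θ : ℝ) : ℂ) * ⟪sandwich U x W i j, sandwich U x W i l⟫_ℂ = 0) ∧
      (∀ j, ∑ i, s i ^ θ * ‖sandwich U x W i j‖ ^ 2 ≤ m * t j ^ θ) ∧
      (∀ i l, i ≠ l →
        ∑ j, ((t j ^ (1 - θ) : ℝ) : ℂ) * ⟪sandwich U x W i j, sandwich U x W l j⟫_ℂ = 0) ∧
      ∀ i, ∑ j, t j ^ (1 - θ) * ‖sandwich U x W i j‖ ^ 2 ≤ m * s i ^ (1 - θ) := by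
  obtain ⟨U, hU, W, hW, s, hs, t, ht, hmax⟩ := exists_sandwich_maximizer hθ0 hθ1 ε x
  obtain ⟨htpos, hc, hc'⟩ := orthogonal_columns_of_forall_le hθ0 hθ1
    (fun i => Real.rpow_nonneg (hs.1 i) θ) (sum_rpow_pos_of_mem_stdSimplex θ hs) hε
    (sandwich U x W) ht (fun V hV t' ht' => by
      rw [sandwich_sandwich, one_mul]
      exact hmax U hU _ (mul_mem hW hV) s hs t' ht')
  have hswap : ∀ (s t : Fin n → ℝ) (z : Matrix (Fin n) (Fin n) H),
      ∑ j, ∑ i, t j ^ (1 - θ) * s i ^ (1 - (1 - θ)) * (‖z.transpose j i‖ ^ 2 + ε) =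
        ∑ i, ∑ j, s i ^ θ * t j ^ (1 - θ) * (‖z i j‖ ^ 2 + ε) := fun s t z => by
    rw [Finset.sum_comm, sub_sub_cancel]
    exact Finset.sum_congr rfl fun i _ => Finset.sum_congr rfl fun j _ => by
      rw [Matrix.transpose_apply]; ring
  -- The row relations are the column relations of the transpose, with `θ` and `1 - θ` exchanged;
  -- right multiplication by `V` becomes left multiplication by its transpose.
  obtain ⟨hspos, hr, hr'⟩ := orthogonal_columns_of_forall_le (θ := 1 - θ) (by linarith)
    (by linarith) (fun j => Real.rpow_nonneg (ht.1 j) (1 - θ))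
    (sum_rpow_pos_of_mem_stdSimplex (1 - θ) ht) hε
    (sandwich U x W).transpose hs (fun V hV s' hs' => by
      have : sandwich 1 (sandwich U x W).transpose V =
          (sandwich (V.transpose * U) x W).transpose := by
        have h := sandwich_sandwich V.transpose U 1 W x
        rw [mul_one] at h
        rw [← h]
        ext i j
        rw [sandwich_one_left_apply, Matrix.transpose_apply, sandwich_one_right_apply]
        rfl
      rw [this, hswap, hswap]
      exact hmax _ (mul_mem (transpose_mem_unitaryGroup hV) hU) W hW s' hs' t ht)
  rw [hswap] at hr'
  exact ⟨U, hU, W, hW, s, hs, t, ht, _, rfl, hspos, htpos, hc, hc', hr, hr'⟩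

end Maximizer

/-! ### The analytic function on the strip and its boundary values -/

theorem concreteMatrixNorm_smul {V B : Type*} [AddCommGroup V] [Module ℂ V]
    [NonUnitalCStarAlgebra B] [PartialOrder B] [StarOrderedRing B] (ι : V →ₗ[ℂ] B)
    (n : ℕ) (c : ℂ) (x : Matrix (Fin n) (Fin n) V) :
    concreteMatrixNorm ι n (c • x) = ‖c‖ₑ * concreteMatrixNorm ι n x := by
  rw [concreteMatrixNorm, concreteMatrixNorm, ← enorm_smul]
  congr 1
  ext i j
  simp

/-- The analytic function `a^((θ - z)/2) x b^((z - θ)/2)` for positive diagonal `a` and `b`. -/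
noncomputable def weightedStrip {n : ℕ} {V : Type*} [AddCommGroup V] [Module ℂ V] (θ : ℝ)
    (s t : Fin n → ℝ) (y : Matrix (Fin n) (Fin n) V) (z : ℂ) : Matrix (Fin n) (Fin n) V :=
  Matrix.of fun i j =>
    (Complex.exp (Real.log (s i) * ((θ - z) / 2)) * Complex.exp (Real.log (t j) * ((z - θ) / 2))) •
      y i j

theorem norm_exp_log_mul_sq {a : ℝ} (ha : 0 < a) (z : ℂ) :
    ‖Complex.exp (Real.log a * (z / 2))‖ ^ 2 = a ^ z.re := by
  rw [Complex.norm_exp, ← Real.exp_nat_mul, Real.rpow_def_of_pos ha]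
  congr 1
  simp
  ring

section Boundary

variable {n : ℕ} {θ m : ℝ} {s t : Fin n → ℝ} {y : Matrix (Fin n) (Fin n) EllTwo}

/-- On `Re z = 0` the squared modulus of the row factor is `s_i^θ`, exactly the weight in the Gram
relations, and that of the column factor is `t_j^(-θ)`, which cancels the `t_j^θ` in `hdiag`. -/
theorem column_weightedStrip_le (hs : ∀ i, 0 < s i) (ht : ∀ j, 0 < t j) (hm : 0 ≤ m)
    (horth : ∀ j l, j ≠ l → ∑ i, ((s i ^ θ : ℝ) : ℂ) * ⟪y i j, y i l⟫_ℂ = 0)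
    (hdiag : ∀ j, ∑ i, s i ^ θ * ‖y i j‖ ^ 2 ≤ m * t j ^ θ) {z : ℂ} (hz : z.re = 0) :
    concreteMatrixNorm columnEmbedding n (weightedStrip θ s t y z) ≤
      ENNReal.ofReal (Real.sqrt m) := by
  have ha : ∀ i, ‖Complex.exp (Real.log (s i) * ((θ - z) / 2))‖ ^ 2 = s i ^ θ := fun i => by
    rw [norm_exp_log_mul_sq (hs i)]; simp [hz]
  have hb : ∀ j, ‖Complex.exp (Real.log (t j) * ((z - θ) / 2))‖ ^ 2 = t j ^ (-θ) := fun i => by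
    rw [norm_exp_log_mul_sq (ht i)]; simp [hz]
  refine columnMatrixNorm_le (Real.sqrt_nonneg _) (fun j l hjl => ?_) fun j => ?_
  · set b := fun j => Complex.exp (Real.log (t j) * ((z - θ) / 2))
    rw [← mul_zero (star (b j) * b l), ← horth j l hjl, Finset.mul_sum]
    refine Finset.sum_congr rfl fun i _ => ?_
    simp only [weightedStrip, Matrix.of_apply, inner_smul_left, inner_smul_right]
    rw [← ha i]
    push_cast
    rw [← Complex.conj_mul', map_mul]
    simp only [RCLike.star_def, b]
    ring
  · rw [Real.sq_sqrt hm]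
    calc _ = t j ^ (-θ) * ∑ i, s i ^ θ * ‖y i j‖ ^ 2 := by
          rw [Finset.mul_sum]
          refine Finset.sum_congr rfl fun i _ => ?_
          simp only [weightedStrip, Matrix.of_apply, norm_smul, norm_mul, mul_pow, ha, hb]
          ring
      _ ≤ t j ^ (-θ) * (m * t j ^ θ) :=
          mul_le_mul_of_nonneg_left (hdiag j) (Real.rpow_nonneg (ht j).le _)
      _ = m := by
          rw [mul_left_comm, ← Real.rpow_add (ht j), neg_add_cancel, Real.rpow_zero, mul_one]

theorem row_weightedStrip_le (hs : ∀ i, 0 < s i) (ht : ∀ j, 0 < t j) (hm : 0 ≤ m)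
    (horth : ∀ i l, i ≠ l → ∑ j, ((t j ^ (1 - θ) : ℝ) : ℂ) * ⟪y i j, y l j⟫_ℂ = 0)
    (hdiag : ∀ i, ∑ j, t j ^ (1 - θ) * ‖y i j‖ ^ 2 ≤ m * s i ^ (1 - θ)) {z : ℂ}
    (hz : z.re = 1) :
    concreteMatrixNorm rowEmbedding n (weightedStrip θ s t y z) ≤
      ENNReal.ofReal (Real.sqrt m) := by
  have ha : ∀ i, ‖Complex.exp (Real.log (s i) * ((θ - z) / 2))‖ ^ 2 = s i ^ (-(1 - θ)) :=
    fun i => by rw [norm_exp_log_mul_sq (hs i)]; simp [hz]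
  have hb : ∀ j, ‖Complex.exp (Real.log (t j) * ((z - θ) / 2))‖ ^ 2 = t j ^ (1 - θ) :=
    fun i => by rw [norm_exp_log_mul_sq (ht i)]; simp [hz]
  refine rowMatrixNorm_le (Real.sqrt_nonneg _) (fun i l hil => ?_) fun i => ?_
  · set a := fun i => Complex.exp (Real.log (s i) * ((θ - z) / 2))
    rw [← mul_zero (star (a i) * a l), ← horth i l hil, Finset.mul_sum]
    refine Finset.sum_congr rfl fun j _ => ?_
    simp only [weightedStrip, Matrix.of_apply, inner_smul_left, inner_smul_right]
    rw [← hb j]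
    push_cast
    rw [← Complex.conj_mul', map_mul]
    simp only [RCLike.star_def, a]
    ring
  · rw [Real.sq_sqrt hm]
    calc _ = s i ^ (-(1 - θ)) * ∑ j, t j ^ (1 - θ) * ‖y i j‖ ^ 2 := by
          rw [Finset.mul_sum]
          refine Finset.sum_congr rfl fun j _ => ?_
          simp only [weightedStrip, Matrix.of_apply, norm_smul, norm_mul, mul_pow, ha, hb]
          ring
      _ ≤ s i ^ (-(1 - θ)) * (m * s i ^ (1 - θ)) :=
          mul_le_mul_of_nonneg_left (hdiag i) (Real.rpow_nonneg (hs i).le _)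
      _ = m := by
          rw [mul_left_comm, ← Real.rpow_add (hs i), neg_add_cancel, Real.rpow_zero, mul_one]

end Boundary

/-- The damping factor is 1 at `z = θ`, decays like a Gaussian along vertical lines and costs at
most `e^δ` on the strip. -/
theorem norm_exp_sq_sub_le {θ δ : ℝ} (hδ : 0 ≤ δ) {z : ℂ} (h0 : 0 ≤ z.re) (h1 : z.re ≤ 1) :
    ‖Complex.exp (δ * (z ^ 2 - θ ^ 2))‖ ≤ Real.exp δ * Real.exp (-δ * z.im ^ 2) := by
  rw [Complex.norm_exp, ← Real.exp_add]
  refine Real.exp_le_exp.2 ?_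
  have : ((δ : ℂ) * (z ^ 2 - (θ : ℂ) ^ 2)).re = δ * (z.re ^ 2 - z.im ^ 2 - θ ^ 2) := by
    simp [sq]
  rw [this]
  nlinarith [mul_nonneg hδ (sq_nonneg θ), mul_nonneg hδ (sub_nonneg.2 (show z.re ^ 2 ≤ 1 by nlinarith))]

theorem tendsto_ofReal_mul_exp_neg_sq (K : ℝ) {δ : ℝ} (hδ : 0 < δ) :
    Filter.Tendsto (fun τ : ℝ => ENNReal.ofReal (Real.exp δ * Real.exp (-δ * τ ^ 2) * K))
      (Filter.cocompact ℝ) (nhds 0) := by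
  have h : Filter.Tendsto (fun τ : ℝ => -δ * τ ^ 2) (Filter.cocompact ℝ) Filter.atBot := by
    have h2 : Filter.Tendsto (fun τ : ℝ => ‖τ‖ ^ 2) (Filter.cocompact ℝ) Filter.atTop :=
      (Filter.tendsto_pow_atTop two_ne_zero).comp tendsto_norm_cocompact_atTop
    have := h2.const_mul_atTop_of_neg (neg_lt_zero.2 hδ)
    simpa using this
  have h3 := ((Real.tendsto_exp_atBot.comp h).const_mul (Real.exp δ)).mul_const K
  rw [mul_zero, zero_mul] at h3
  simpa using ENNReal.tendsto_ofReal h3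

theorem norm_exp_mul_div_two_le (a : ℝ) {z : ℂ} (hz : |z.re| ≤ 1) :
    ‖Complex.exp (a * (z / 2))‖ ≤ Real.exp |a| := by
  rw [Complex.norm_exp]
  refine Real.exp_le_exp.2 ?_
  have : ((a : ℂ) * (z / 2)).re = a * z.re / 2 := by simp; ring
  rw [this]
  have h := abs_mul a z.re
  have h2 : |a| * |z.re| ≤ |a| * 1 := mul_le_mul_of_nonneg_left hz (abs_nonneg _)
  have := le_abs_self (a * z.re)
  have := abs_nonneg a
  linarith

/-! ### Upper bound for the interpolation norm -/

section Interpolation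

variable {n : ℕ}

/-- The extremal function of the interpolation problem, damped at infinity. -/
noncomputable def dampedStrip (θ δ : ℝ) (U W : Matrix (Fin n) (Fin n) ℂ) (s t : Fin n → ℝ)
    (y : Matrix (Fin n) (Fin n) EllTwo) (z : ℂ) : Fin n → Fin n → EllTwo :=
  Complex.exp (δ * (z ^ 2 - θ ^ 2)) • sandwich U (weightedStrip θ s t y z) W

theorem dampedStrip_apply (θ δ : ℝ) (U W : Matrix (Fin n) (Fin n) ℂ) (s t : Fin n → ℝ)
    (y : Matrix (Fin n) (Fin n) EllTwo) (z : ℂ) (i j : Fin n) :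
    dampedStrip θ δ U W s t y z i j = Complex.exp (δ * (z ^ 2 - θ ^ 2)) •
      ∑ k, ∑ l, (U i k * W l j) • (Complex.exp (Real.log (s k) * ((θ - z) / 2)) *
        Complex.exp (Real.log (t l) * ((z - θ) / 2))) • y k l := rfl

theorem differentiable_dampedStrip (θ δ : ℝ) (U W : Matrix (Fin n) (Fin n) ℂ) (s t : Fin n → ℝ)
    (y : Matrix (Fin n) (Fin n) EllTwo) : Differentiable ℂ (dampedStrip θ δ U W s t y) := by
  refine differentiable_pi.2 fun i => differentiable_pi.2 fun j => ?_
  simp only [dampedStrip_apply]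
  fun_prop

theorem dampedStrip_bounded {θ δ : ℝ} (hθ0 : 0 < θ) (hθ1 : θ < 1) (hδ : 0 < δ)
    (U W : Matrix (Fin n) (Fin n) ℂ) (s t : Fin n → ℝ) (y : Matrix (Fin n) (Fin n) EllTwo) :
    ∃ M : ℝ, ∀ z : ℂ, 0 ≤ z.re → z.re ≤ 1 → ‖dampedStrip θ δ U W s t y z‖ ≤ M := by
  set b : Fin n → Fin n → ℝ := fun i j => Real.exp δ * ∑ k, ∑ l, ‖U i k * W l j‖ *
    (Real.exp |Real.log (s k)| * Real.exp |Real.log (t l)| * ‖y k l‖)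
  have hb : ∀ i j, 0 ≤ b i j := fun i j => by positivity
  refine ⟨∑ i, ∑ j, b i j, fun z h0 h1 => ?_⟩
  refine (pi_norm_le_iff_of_nonneg (Finset.sum_nonneg fun i _ =>
    Finset.sum_nonneg fun j _ => hb i j)).2 fun i => ?_
  refine le_trans ?_ (Finset.single_le_sum (f := fun i => ∑ j, b i j)
    (fun i _ => Finset.sum_nonneg fun j _ => hb i j) (Finset.mem_univ i))
  refine (pi_norm_le_iff_of_nonneg (Finset.sum_nonneg fun j _ => hb i j)).2 fun j => ?_
  refine le_trans ?_ (Finset.single_le_sum (f := fun j => b i j)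
    (fun j _ => hb i j) (Finset.mem_univ j))
  rw [dampedStrip_apply, norm_smul]
  refine mul_le_mul ?_ ?_ (norm_nonneg _) (Real.exp_nonneg _)
  · refine (norm_exp_sq_sub_le hδ.le h0 h1).trans ?_
    refine mul_le_of_le_one_right (Real.exp_nonneg _) (Real.exp_le_one_iff.2 ?_)
    nlinarith [mul_nonneg hδ.le (sq_nonneg z.im)]
  · refine (norm_sum_le _ _).trans (Finset.sum_le_sum fun k _ => (norm_sum_le _ _).trans
      (Finset.sum_le_sum fun l _ => ?_))
    rw [norm_smul, norm_smul, norm_mul (Complex.exp _)]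
    gcongr
    · refine norm_exp_mul_div_two_le _ (abs_le.2 ?_)
      simp only [Complex.sub_re, Complex.ofReal_re]
      constructor <;> linarith
    · refine norm_exp_mul_div_two_le _ (abs_le.2 ?_)
      simp only [Complex.sub_re, Complex.ofReal_re]
      constructor <;> linarith

theorem concreteMatrixNorm_dampedStrip_le {B : Type*} [NonUnitalCStarAlgebra B] [PartialOrder B]
    [StarOrderedRing B] (ι : EllTwo →ₗ[ℂ] B) {θ δ K : ℝ} (hδ : 0 < δ)
    {U W : Matrix (Fin n) (Fin n) ℂ} (hU : U ∈ Matrix.unitaryGroup (Fin n) ℂ)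
    (hW : W ∈ Matrix.unitaryGroup (Fin n) ℂ) {s t : Fin n → ℝ}
    {y : Matrix (Fin n) (Fin n) EllTwo} {z : ℂ} (h0 : 0 ≤ z.re) (h1 : z.re ≤ 1)
    (h : concreteMatrixNorm ι n (weightedStrip θ s t y z) ≤ ENNReal.ofReal K) :
    concreteMatrixNorm ι n (Matrix.of (dampedStrip θ δ U W s t y z)) ≤
      ENNReal.ofReal (Real.exp δ * Real.exp (-δ * z.im ^ 2) * K) := by
  have : Matrix.of (dampedStrip θ δ U W s t y z) = Complex.exp (δ * (z ^ 2 - θ ^ 2)) •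
      sandwich U (weightedStrip θ s t y z) W := rfl
  rw [this, concreteMatrixNorm_smul, concreteMatrixNorm_sandwich ι U W hU hW,
    ENNReal.ofReal_mul (by positivity), ← ofReal_norm]
  exact mul_le_mul' (ENNReal.ofReal_le_ofReal (norm_exp_sq_sub_le hδ.le h0 h1)) h

theorem weightedStrip_self {V : Type*} [AddCommGroup V] [Module ℂ V] (θ : ℝ) (s t : Fin n → ℝ)
    (y : Matrix (Fin n) (Fin n) V) : weightedStrip θ s t y θ = y := by
  ext i j
  simp [weightedStrip]

theorem interpolatedMatrixNorm_le_of_strip {θ δ K : ℝ} (hθ0 : 0 < θ) (hθ1 : θ < 1) (hδ : 0 < δ)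
    (hK : 0 ≤ K)
    {U W : Matrix (Fin n) (Fin n) ℂ} (hU : U ∈ Matrix.unitaryGroup (Fin n) ℂ)
    (hW : W ∈ Matrix.unitaryGroup (Fin n) ℂ) {s t : Fin n → ℝ}
    {y : Matrix (Fin n) (Fin n) EllTwo}
    (hcol : ∀ z : ℂ, z.re = 0 →
      concreteMatrixNorm columnEmbedding n (weightedStrip θ s t y z) ≤ ENNReal.ofReal K)
    (hrow : ∀ z : ℂ, z.re = 1 →
      concreteMatrixNorm rowEmbedding n (weightedStrip θ s t y z) ≤ ENNReal.ofReal K) :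
    interpolatedMatrixNorm θ n (sandwich U y W) ≤ ENNReal.ofReal (Real.exp δ * K) := by
  have hl : ∀ τ : ℝ, concreteMatrixNorm columnEmbedding n
      (Matrix.of (dampedStrip θ δ U W s t y (Complex.I * (τ : ℂ)))) ≤
      ENNReal.ofReal (Real.exp δ * Real.exp (-δ * τ ^ 2) * K) := fun τ => by
    have := concreteMatrixNorm_dampedStrip_le columnEmbedding hδ hU hW
      (z := Complex.I * (τ : ℂ)) (by simp) (by simp) (hcol _ (by simp))
    simpa using this
  have hr : ∀ τ : ℝ, concreteMatrixNorm rowEmbedding n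
      (Matrix.of (dampedStrip θ δ U W s t y (1 + Complex.I * (τ : ℂ)))) ≤
      ENNReal.ofReal (Real.exp δ * Real.exp (-δ * τ ^ 2) * K) := fun τ => by
    have := concreteMatrixNorm_dampedStrip_le rowEmbedding hδ hU hW
      (z := 1 + Complex.I * (τ : ℂ)) (by simp) (by simp) (hrow _ (by simp))
    simpa using this
  have hle : ∀ τ : ℝ, ENNReal.ofReal (Real.exp δ * Real.exp (-δ * τ ^ 2) * K) ≤
      ENNReal.ofReal (Real.exp δ * K) := fun τ => by
    refine ENNReal.ofReal_le_ofReal (mul_le_mul_of_nonneg_right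
      (mul_le_of_le_one_right (Real.exp_nonneg _) (Real.exp_le_one_iff.2 ?_)) hK)
    nlinarith [mul_nonneg hδ.le (sq_nonneg τ)]
  have hF : IsCalderonFunction (X := Fin n → Fin n → EllTwo)
      (fun y => concreteMatrixNorm columnEmbedding n (Matrix.of y))
      (fun y => concreteMatrixNorm rowEmbedding n (Matrix.of y)) (dampedStrip θ δ U W s t y) :=
    { continuousOn := (differentiable_dampedStrip θ δ U W s t y).continuous.continuousOn
      bounded := dampedStrip_bounded hθ0 hθ1 hδ U W s t y
      holomorphicOn := (differentiable_dampedStrip θ δ U W s t y).differentiableOn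
      tendsto_zero_left := tendsto_of_tendsto_of_tendsto_of_le_of_le tendsto_const_nhds
        (tendsto_ofReal_mul_exp_neg_sq K hδ) (fun _ => zero_le) hl
      tendsto_zero_right := tendsto_of_tendsto_of_tendsto_of_le_of_le tendsto_const_nhds
        (tendsto_ofReal_mul_exp_neg_sq K hδ) (fun _ => zero_le) hr }
  have hθ : dampedStrip θ δ U W s t y (θ : ℂ) = sandwich U y W := by
    rw [dampedStrip, weightedStrip_self, sub_self, mul_zero, Complex.exp_zero, one_smul]
  exact iInf_le_of_le (dampedStrip θ δ U W s t y) (iInf_le_of_le hF (iInf_le_of_le hθ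
    (max_le (iSup_le fun τ => (hl τ).trans (hle τ)) (iSup_le fun τ => (hr τ).trans (hle τ)))))

/-- The upper estimate of the norm of `M_n((C, R)_θ)` by weighted Hilbert-Schmidt norms. -/
theorem interpolatedMatrixNorm_le {θ : ℝ} (hθ0 : 0 < θ) (hθ1 : θ < 1) {K : ℝ} (hK : 0 ≤ K)
    (x : Matrix (Fin n) (Fin n) EllTwo)
    (h : ∀ U ∈ Matrix.unitaryGroup (Fin n) ℂ, ∀ W ∈ Matrix.unitaryGroup (Fin n) ℂ,
      ∀ s ∈ stdSimplex ℝ (Fin n), ∀ t ∈ stdSimplex ℝ (Fin n),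
        ∑ i, ∑ j, s i ^ θ * t j ^ (1 - θ) * ‖sandwich U x W i j‖ ^ 2 ≤ K ^ 2) :
    interpolatedMatrixNorm θ n x ≤ ENNReal.ofReal K := by
  have key : ∀ δ : ℝ, 0 < δ → interpolatedMatrixNorm θ n x ≤
      ENNReal.ofReal (Real.exp δ * Real.sqrt (K ^ 2 + δ * (n * n))) := by
    intro δ hδ
    rcases Nat.eq_zero_or_pos n with rfl | hn
    -- For `n = 0` the simplex is empty and there is no maximizer, but all norms are trivial.
    · rw [Subsingleton.elim x (sandwich 1 (0 : Matrix (Fin 0) (Fin 0) EllTwo) 1)]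
      refine interpolatedMatrixNorm_le_of_strip (s := 0) (t := 0) hθ0 hθ1 hδ (Real.sqrt_nonneg _)
        (one_mem _) (one_mem _) (fun z _ => ?_) fun z _ => ?_
      · exact columnMatrixNorm_le (Real.sqrt_nonneg _) (fun j => j.elim0) fun j => j.elim0
      · exact rowMatrixNorm_le (Real.sqrt_nonneg _) (fun j => j.elim0) fun j => j.elim0
    have : NeZero n := ⟨hn.ne'⟩
    -- The same `δ` serves as regularization `ε` and as damping parameter.
    obtain ⟨U, hU, W, hW, s, hs, t, ht, m, hm, hspos, htpos, hc, hc', hr, hr'⟩ :=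
      exists_sandwich_orthogonal hθ0 hθ1 hδ x
    have hs1 : ∀ i, s i ≤ 1 := fun i =>
      hs.2 ▸ Finset.single_le_sum (fun i _ => hs.1 i) (Finset.mem_univ i)
    have ht1 : ∀ i, t i ≤ 1 := fun i =>
      ht.2 ▸ Finset.single_le_sum (fun i _ => ht.1 i) (Finset.mem_univ i)
    have hm0 : 0 ≤ m := by
      rw [hm]
      exact Finset.sum_nonneg fun i _ => Finset.sum_nonneg fun j _ =>
        mul_nonneg (mul_nonneg (Real.rpow_nonneg (hs.1 i) _) (Real.rpow_nonneg (ht.1 j) _))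
          (by positivity)
    -- The weights are at most 1, so regularizing the `n²` entries adds at most `δ n²`.
    have hmle : m ≤ K ^ 2 + δ * (n * n) := by
      have h1 : ∑ i, ∑ j, s i ^ θ * t j ^ (1 - θ) * δ ≤ δ * (n * n) := by
        calc _ ≤ ∑ _i : Fin n, ∑ _j : Fin n, δ := by
              refine Finset.sum_le_sum fun i _ => Finset.sum_le_sum fun j _ =>
                mul_le_of_le_one_left hδ.le (mul_le_one₀ ?_ ?_ ?_)
              · exact Real.rpow_le_one (hs.1 i) (hs1 i) hθ0.le
              · exact Real.rpow_nonneg (ht.1 j) _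
              · exact Real.rpow_le_one (ht.1 j) (ht1 j) (by linarith)
          _ = _ := by simp; ring
      have h2 := h U hU W hW s hs t ht
      rw [hm]
      simp only [mul_add, Finset.sum_add_distrib]
      exact add_le_add h2 h1
    have hx : x = sandwich (star U) (sandwich U x W) (star W) := by
      rw [sandwich_sandwich, Matrix.mem_unitaryGroup_iff'.1 hU, Matrix.mem_unitaryGroup_iff.1 hW,
        sandwich_one_one]
    rw [hx]
    refine (interpolatedMatrixNorm_le_of_strip hθ0 hθ1 hδ (Real.sqrt_nonneg m)
      (Unitary.star_mem hU) (Unitary.star_mem hW)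
      (fun z hz => column_weightedStrip_le hspos htpos hm0 hc hc' hz)
      (fun z hz => row_weightedStrip_le hspos htpos hm0 hr hr' hz)).trans ?_
    exact ENNReal.ofReal_le_ofReal (mul_le_mul_of_nonneg_left (Real.sqrt_le_sqrt hmle)
      (Real.exp_nonneg _))
  have hlim : Filter.Tendsto
      (fun δ : ℝ => ENNReal.ofReal (Real.exp δ * Real.sqrt (K ^ 2 + δ * (n * n))))
      (nhdsWithin 0 (Set.Ioi 0)) (nhds (ENNReal.ofReal K)) := by
    refine ENNReal.tendsto_ofReal ?_
    have hc : Continuous fun δ : ℝ => Real.exp δ * Real.sqrt (K ^ 2 + δ * (n * n)) := by fun_prop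
    have := hc.tendsto 0
    simp only [Real.exp_zero, zero_mul, add_zero, one_mul, Real.sqrt_sq hK] at this
    exact this.mono_left nhdsWithin_le_nhds
  exact ge_of_tendsto hlim (eventually_nhdsWithin_of_forall fun δ hδ => key δ hδ)

end Interpolation

/-! ### The estimate from the two states -/

section State

open CStarMatrix

variable {A : Type*} [NonUnitalCStarAlgebra A]

theorem IsState.re_nonneg {f : A →L[ℂ] ℂ} (hf : IsState f) (a : A) : 0 ≤ (f (star a * a)).re :=
  (Complex.le_def.1 (hf.nonneg a)).1

theorem IsState.re_le_norm {f : A →L[ℂ] ℂ} (hf : IsState f) (a : A) : (f a).re ≤ ‖a‖ := by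
  refine (Complex.re_le_norm _).trans ((f.le_opNorm a).trans ?_)
  rw [hf.norm_eq_one, one_mul]

variable [PartialOrder A] [StarOrderedRing A] {n : ℕ}

/-- The sum is `f` applied to a diagonal entry of `x* x`, whose norm is at most `‖x‖²`. -/
theorem IsState.sum_star_mul_self_le {f : A →L[ℂ] ℂ} (hf : IsState f)
    {x : Matrix (Fin n) (Fin n) A} (hx : ‖ofMatrix x‖ ≤ 1) (j : Fin n) :
    ∑ i, (f (star (x i j) * x i j)).re ≤ 1 := by
  have h : (star (ofMatrix x) * ofMatrix x) j j = ∑ i, star (x i j) * x i j := by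
    simp [CStarMatrix.mul_apply, CStarMatrix.star_apply]
  rw [← Complex.re_sum, ← map_sum, ← h]
  refine (hf.re_le_norm _).trans (norm_entry_le_norm.trans ?_)
  rw [CStarRing.norm_star_mul_self]
  exact mul_le_one₀ hx (norm_nonneg _) hx

theorem IsState.sum_mul_star_self_le {f : A →L[ℂ] ℂ} (hf : IsState f)
    {x : Matrix (Fin n) (Fin n) A} (hx : ‖ofMatrix x‖ ≤ 1) (i : Fin n) :
    ∑ j, (f (x i j * star (x i j))).re ≤ 1 := by
  have h : (ofMatrix x * star (ofMatrix x)) i i = ∑ j, x i j * star (x i j) := by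
    simp [CStarMatrix.mul_apply, CStarMatrix.star_apply]
  rw [← Complex.re_sum, ← map_sum, ← h]
  refine (hf.re_le_norm _).trans (norm_entry_le_norm.trans ?_)
  rw [CStarRing.norm_self_mul_star]
  exact mul_le_one₀ hx (norm_nonneg _) hx

theorem sum_weighted_norm_sq_le {θ : ℝ} (hθ0 : 0 < θ) (hθ1 : θ < 1) {E : Submodule ℂ A}
    {u : E →ₗ[ℂ] EllTwo} {f g : A →L[ℂ] ℂ} (hf : IsState f) (hg : IsState g) {C : ℝ≥0}
    (hu : ∀ a : E, ‖u a‖ ≤ (C : ℝ) * (f (star (a : A) * (a : A))).re ^ ((1 - θ) / 2) *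
      (g ((a : A) * star (a : A))).re ^ (θ / 2))
    {x : Matrix (Fin n) (Fin n) E} (hx : ‖ofMatrix (x.map E.subtype)‖ ≤ 1) {s t : Fin n → ℝ}
    (hs : s ∈ stdSimplex ℝ (Fin n)) (ht : t ∈ stdSimplex ℝ (Fin n)) :
    ∑ i, ∑ j, s i ^ θ * t j ^ (1 - θ) * ‖u (x i j)‖ ^ 2 ≤ (C : ℝ) ^ 2 := by
  set p : Fin n → Fin n → ℝ := fun i j => (f (star (x i j : A) * (x i j : A))).re with hp
  set q : Fin n → Fin n → ℝ := fun i j => (g ((x i j : A) * star (x i j : A))).re with hq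
  have hp0 : ∀ i j, 0 ≤ p i j := fun i j => hf.re_nonneg _
  have hq0 : ∀ i j, 0 ≤ q i j := fun i j => by
    have := hg.re_nonneg (star (x i j : A)); rwa [star_star] at this
  have hpsum : ∀ j, ∑ i, p i j ≤ 1 := fun j => hf.sum_star_mul_self_le hx j
  have hqsum : ∀ i, ∑ j, q i j ≤ 1 := fun i => hg.sum_mul_star_self_le hx i
  have hsq : ∀ {a : ℝ} (r : ℝ), 0 ≤ a → (a ^ (r / 2)) ^ 2 = a ^ r := fun {a} r ha => by
    rw [← Real.rpow_natCast, ← Real.rpow_mul ha]; norm_num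
  -- The exponents match so that `s_i` pairs with `x x*`, summed along rows, and `t_j` with `x* x`,
  -- summed along columns.
  have hterm : ∀ i j, s i ^ θ * t j ^ (1 - θ) * ‖u (x i j)‖ ^ 2 ≤
      (C : ℝ) ^ 2 * (θ * (s i * q i j) + (1 - θ) * (t j * p i j)) := fun i j => by
    have h1 : ‖u (x i j)‖ ^ 2 ≤ (C : ℝ) ^ 2 * (p i j ^ (1 - θ) * q i j ^ θ) := by
      refine (pow_le_pow_left₀ (norm_nonneg _) (hu (x i j)) 2).trans (le_of_eq ?_)
      rw [mul_pow, mul_pow, hsq _ (hp0 i j), hsq _ (hq0 i j), mul_assoc]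
    calc _ ≤ s i ^ θ * t j ^ (1 - θ) * ((C : ℝ) ^ 2 * (p i j ^ (1 - θ) * q i j ^ θ)) :=
          mul_le_mul_of_nonneg_left h1
            (mul_nonneg (Real.rpow_nonneg (hs.1 i) _) (Real.rpow_nonneg (ht.1 j) _))
      _ = (C : ℝ) ^ 2 * ((s i * q i j) ^ θ * (t j * p i j) ^ (1 - θ)) := by
          rw [Real.mul_rpow (hs.1 i) (hq0 i j), Real.mul_rpow (ht.1 j) (hp0 i j)]; ring
      _ ≤ _ := mul_le_mul_of_nonneg_left (Real.rpow_mul_rpow_le_weighted hθ0 hθ1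
          (mul_nonneg (hs.1 i) (hq0 i j)) (mul_nonneg (ht.1 j) (hp0 i j))) (sq_nonneg _)
  have hS : ∑ i, ∑ j, s i * q i j ≤ 1 := by
    rw [← hs.2]
    refine Finset.sum_le_sum fun i _ => ?_
    rw [← Finset.mul_sum]
    exact mul_le_of_le_one_right (hs.1 i) (hqsum i)
  have hT : ∑ i, ∑ j, t j * p i j ≤ 1 := by
    rw [Finset.sum_comm, ← ht.2]
    refine Finset.sum_le_sum fun j _ => ?_
    rw [← Finset.mul_sum]
    exact mul_le_of_le_one_right (ht.1 j) (hpsum j)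
  calc _ ≤ ∑ i, ∑ j, (C : ℝ) ^ 2 * (θ * (s i * q i j) + (1 - θ) * (t j * p i j)) :=
        Finset.sum_le_sum fun i _ => Finset.sum_le_sum fun j _ => hterm i j
    _ = (C : ℝ) ^ 2 * (θ * ∑ i, ∑ j, s i * q i j + (1 - θ) * ∑ i, ∑ j, t j * p i j) := by
        simp only [Finset.mul_sum, ← Finset.sum_add_distrib]
    _ ≤ (C : ℝ) ^ 2 * 1 := by
        refine mul_le_mul_of_nonneg_left ?_ (sq_nonneg _)
        nlinarith
    _ = _ := mul_one _

end State

/-! ### Conclusion -/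

theorem proposition2 {A : Type*} [NonUnitalCStarAlgebra A] [PartialOrder A] [StarOrderedRing A]
    (θ : ℝ) (hθ0 : 0 < θ) (hθ1 : θ < 1)
    (E : Submodule ℂ A) (u : E →ₗ[ℂ] EllTwo)
    (f g : A →L[ℂ] ℂ) (hf : IsState f) (hg : IsState g) (C : ℝ≥0)
    (hu : ∀ a : E, ‖u a‖ ≤ (C : ℝ) * (f (star (a : A) * (a : A))).re ^ ((1 - θ) / 2) *
      (g ((a : A) * star (a : A))).re ^ (θ / 2)) :
    IsCompletelyBounded (concreteMatrixNorm E.subtype) (interpolatedMatrixNorm θ) u ∧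
      cbNorm (concreteMatrixNorm E.subtype) (interpolatedMatrixNorm θ) u ≤ (C : ℝ≥0∞) := by
  have h : cbNorm (concreteMatrixNorm E.subtype) (interpolatedMatrixNorm θ) u ≤ (C : ℝ≥0∞) := by
    refine iSup_le fun n => iSup_le fun x => iSup_le fun hx => ?_
    rw [← ENNReal.ofReal_coe_nnreal]
    refine interpolatedMatrixNorm_le hθ0 hθ1 C.2 _ fun U hU W hW s hs t ht => ?_
    -- The unitaries pass through `u` and act on `x`, where they preserve the unit ball of `M_n(A)`;
    -- the entries of the product stay in `E`.
    rw [← sandwich_map]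
    refine sum_weighted_norm_sq_le hθ0 hθ1 hf hg hu (x := sandwich U x W) ?_ hs ht
    rw [sandwich_map, norm_sandwich U W hU hW]
    rw [concreteMatrixNorm, ← ofReal_norm] at hx
    exact ENNReal.ofReal_le_one.1 hx
  exact ⟨h.trans_lt ENNReal.coe_lt_top, h⟩
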